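/- Theorem 9.1 (Thue's theorem). A circle packing is a set $X\subset\mathbb R^2$ (the centers of closed unit disks) with $|x-y|\ge 2$ for all distinct $x,y\in X$; it is saturated if it is not a strict subset of another circle packing. For $x\in X$ let $V_X(x)=\{p\in\mathbb R^2:\ |p-x|\le|p-y|\text{ for all }y\in X\}$ be its Voronoi cell and $\delta(V_X(x))=\pi/\operatorname{area}(V_X(x))$ the packing density in this cell (with value $0$ if the area is infinite). The packing density of $X$, measured in the Voronoi cells, is called maximal if $\delta(V_Y(y))\le\delta(V_X(x))$ for all $x\in X$, all circle packings $Y$ and all $y\in Y$. A hexagonal lattice circle packing is a set $X=c+\mathbb Za+\mathbb Zb$ with $c,a,b\in\mathbb R^2$, $|a|=|b|=2$ and $\langle a,b\rangle=2$ (so $a,b$ enclose an angle of $60^\circ$). Let $X$ be a saturated circle packing. Then the packing density of $X$ (measured in the Voronoi cells) is maximal if and only if $X$ is a hexagonal lattice circle packing. Moreover, $\delta(V_X(x))\le\frac{\pi}{2\sqrt3}$ for every $x\in X$. If $X$ is a hexagonal lattice circle packing, then $\delta(V_X(x))=\frac{\pi}{2\sqrt3}$ for every $x\in X$, and $$\lim_{R\to\infty}\frac{\operatorname{area}\big(\bigcup_{x\in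 X}\{p:|p-x|\le1\}\cap\{p:|p|\le R\}\big)}{\operatorname{area}\{p:|p|\le R\}}=\frac{\pi}{2\sqrt3}.$$ For every circle packing $Y$ the corresponding upper density, with $\limsup$ in place of $\lim$ and $Y$ in place of $X$, is at most $\frac{\pi}{2\sqrt3}$. -/

import Mathlib

open MeasureTheory Filter Topology
open scoped ENNReal

/-- The Euclidean plane. -/
abbrev Plane : Type := EuclideanSpace ℝ (Fin 2)

/-- `X` is the set of centers of a packing of closed unit circles (disks): distinct centers have
distance at least `2`. -/
def IsCirclePacking (X : Set Plane) : Prop :=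
  ∀ x ∈ X, ∀ y ∈ X, x ≠ y → 2 ≤ dist x y

/-- A circle packing is saturated if it is not a strict subset of another circle packing. -/
def IsSaturatedPacking (X : Set Plane) : Prop :=
  IsCirclePacking X ∧ ∀ Y : Set Plane, IsCirclePacking Y → ¬ X ⊂ Y

/-- The Voronoi cell of the center `x` in the configuration `X`. -/
def voronoiCell (X : Set Plane) (x : Plane) : Set Plane :=
  {p | ∀ y ∈ X, dist p x ≤ dist p y}

/-- The density of `X` in the Voronoi cell of `x`: the area of the unit circle divided by the area
of the cell (and `0` if the cell has infinite area). -/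
noncomputable def cellDensity (X : Set Plane) (x : Plane) : ℝ≥0∞ :=
  volume (Metric.closedBall x 1) / volume (voronoiCell X x)

/-- The packing density of `X`, measured in the Voronoi cells, is maximal: no Voronoi cell of any
circle packing is filled more densely than the cells of `X`. -/
def HasMaximalDensity (X : Set Plane) : Prop :=
  ∀ x ∈ X, ∀ Y : Set Plane, IsCirclePacking Y → ∀ y ∈ Y, cellDensity Y y ≤ cellDensity X x

/-- The fraction of the area of the disk of radius `R` around the origin that the unit circles around the points
of `X` cover. -/
noncomputable def coveredFraction (X : Set Plane) (R : ℝ) : ℝ≥0∞ :=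
  volume ((⋃ x ∈ X, Metric.closedBall x 1) ∩ Metric.closedBall 0 R) /
    volume (Metric.closedBall (0 : Plane) R)

/-- The upper asymptotic density of a packing of unit circles in the plane. -/
noncomputable def upperDensity (X : Set Plane) : ℝ≥0∞ :=
  limsup (coveredFraction X) atTop

/-- `X` is the set of centers of a hexagonal lattice packing of unit circles: a translate of a
lattice with a basis of two vectors of length `2` that enclose an angle of 60 degrees
(so their inner product is `2 * 2 * (1 / 2) = 2`). -/
def IsHexagonalLatticePacking (X : Set Plane) : Prop :=
  ∃ c a b : Plane, ‖a‖ = 2 ∧ ‖b‖ = 2 ∧ inner ℝ a b = 2 ∧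
    X = {p | ∃ m n : ℤ, p = c + (m : ℝ) • a + (n : ℝ) • b}

/-! Let D be the disk of radius `hexRadius` around a center x. The part of D outside the Voronoi
cell of x is covered by caps, one for each neighbour at distance less than `2 * hexRadius`, cut off
by the bisector with x. The cell therefore has area at least that of D minus the total area of the
caps, and it suffices that the caps together never exceed six caps of neighbours at distance 2. In
the hexagonal lattice the cell lies in D, the six caps are disjoint, and the cell has area 2√3, so D
has area at least 2√3 plus six such caps (`IsHexPair.volume_diskCap_le`). A cap is largest at
distance 2, so only configurations with more than six neighbours matter. Angle estimates exclude
eight, and with seven at least two neighbours lie at distance √5 or more. The cap of such a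
neighbour is less than half a full cap, so the total stays below 5 + 1 full caps
(`IsNearPacking.sum_volume_diskCap_le`). Equality forces exactly six neighbours at distance 2, hence
a regular hexagon. If this holds at every center, the hexagons propagate to a full hexagonal
lattice, which leaves no room for further centers (`isHexagonalLatticePacking`). The asymptotic
densities follow by counting the centers in large disks. -/

/-! ### Three separated points near a common point -/

/-- The circumradius of the equilateral triangle with side `2`. -/
noncomputable def hexRadius : ℝ := 2 / Real.sqrt 3

theorem hexRadius_sq : hexRadius ^ 2 = 4 / 3 := by
  rw [hexRadius, div_pow, Real.sq_sqrt (by norm_num)]; norm_num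

theorem hexRadius_pos : 0 < hexRadius := by
  rw [hexRadius]; positivity

theorem hexRadius_lt_two : hexRadius < 2 := by
  nlinarith [hexRadius_sq, hexRadius_pos]

theorem dist_sq_eq_inner {E : Type*} [NormedAddCommGroup E] [InnerProductSpace ℝ E] (u v : E) :
    dist u v ^ 2 = ‖u‖ ^ 2 - 2 * inner ℝ u v + ‖v‖ ^ 2 := by
  rw [dist_eq_norm, norm_sub_sq_real]

theorem dist_lt_norm_iff {E : Type*} [NormedAddCommGroup E] [InnerProductSpace ℝ E] (p v : E) :
    dist p v < ‖p‖ ↔ ‖v‖ ^ 2 < 2 * inner ℝ p v := by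
  rw [← sq_lt_sq₀ dist_nonneg (norm_nonneg _), dist_sq_eq_inner]
  constructor <;> intro h <;> linarith

/-- Three points with mutual distances at least `2` do not fit into a disk of radius `hexRadius`
unless all lie on its boundary. -/
theorem not_three_points_close {E : Type*} [NormedAddCommGroup E] [InnerProductSpace ℝ E]
    {p x y z : E} (hx : dist p x ≤ hexRadius) (hy : dist p y < hexRadius)
    (hz : dist p z < hexRadius) (hxy : 2 ≤ dist x y) (hyz : 2 ≤ dist y z) (hxz : 2 ≤ dist x z) :
    False := by
  -- The two sides differ by the squared norm of (x - p) + (y - p) + (z - p). The left side is at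
  -- least 12, while the right side is less than 3 · 3 · 4/3 = 12.
  have key : dist x y ^ 2 + dist y z ^ 2 + dist x z ^ 2 ≤
      3 * (dist p x ^ 2 + dist p y ^ 2 + dist p z ^ 2) := by
    have e : ∀ u v : E, dist u v ^ 2 =
        dist p u ^ 2 - 2 * inner ℝ (u - p) (v - p) + dist p v ^ 2 := by
      intro u v
      rw [dist_comm p u, dist_comm p v, dist_eq_norm u p, dist_eq_norm v p, ← dist_sq_eq_inner,
        dist_sub_right]
    have h0 : 0 ≤ ‖(x - p) + (y - p) + (z - p)‖ ^ 2 := by positivity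
    rw [norm_add_sq_real, norm_add_sq_real, inner_add_left, ← dist_eq_norm, ← dist_eq_norm,
      ← dist_eq_norm, dist_comm x p, dist_comm y p, dist_comm z p] at h0
    rw [e x y, e y z, e x z]
    linarith
  have hr := hexRadius_sq
  have h1 : dist p x ^ 2 ≤ hexRadius ^ 2 := by gcongr
  have h2 : dist p y ^ 2 < hexRadius ^ 2 := by gcongr
  have h3 : dist p z ^ 2 < hexRadius ^ 2 := by gcongr
  nlinarith

/-! ### Voronoi cells of a packing -/

theorem IsCirclePacking.finite_inter_closedBall {X : Set Plane} (hX : IsCirclePacking X)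
    (p : Plane) (R : ℝ) : (X ∩ Metric.closedBall p R).Finite := by
  have hsep : X.Pairwise fun x y => (2 : ℝ) ≤ dist x y := fun x hx y hy h => hX x hx y hy h
  rw [Set.inter_comm]
  refine Metric.finite_isBounded_inter_isClosed ?_ Metric.isBounded_closedBall
    (Metric.isClosed_of_pairwise_le_dist two_pos hsep)
  have : DiscreteTopology X := DiscreteTopology.of_forall_le_dist two_pos (fun x y h =>
    hX x x.2 y y.2 (fun h' => h (Subtype.ext h')))
  exact ⟨this⟩

theorem IsCirclePacking.exists_mem_voronoiCell {X : Set Plane} (hX : IsCirclePacking X)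
    (hne : X.Nonempty) (p : Plane) : ∃ x ∈ X, p ∈ voronoiCell X x := by
  obtain ⟨x₀, hx₀⟩ := hne
  obtain ⟨x, hx, hmin⟩ := (hX.finite_inter_closedBall p (dist p x₀)).exists_minimalFor
    (fun y => dist p y) _ ⟨x₀, hx₀, by simp [dist_comm]⟩
  refine ⟨x, hx.1, fun y hy => ?_⟩
  by_contra! h
  have hy' : y ∈ X ∩ Metric.closedBall p (dist p x₀) := by
    refine ⟨hy, ?_⟩
    have := hx.2
    rw [Metric.mem_closedBall, dist_comm] at this ⊢
    linarith
  have := hmin hy' h.le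
  simp only at this
  linarith

theorem isClosed_voronoiCell (X : Set Plane) (x : Plane) : IsClosed (voronoiCell X x) := by
  have : voronoiCell X x = ⋂ y ∈ X, {p | dist p x ≤ dist p y} := by
    ext p; simp [voronoiCell]
  rw [this]
  exact isClosed_biInter fun y _ => isClosed_le (by fun_prop) (by fun_prop)

theorem volume_setOf_dist_eq {x y : Plane} (h : x ≠ y) :
    volume {p : Plane | dist p x = dist p y} = 0 := by
  have : {p : Plane | dist p x = dist p y} = (AffineSubspace.perpBisector x y : Set Plane) := by
    ext p; simp [AffineSubspace.mem_perpBisector_iff_dist_eq]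
  rw [this]
  exact Measure.addHaar_affineSubspace _ _ (by simpa using h)

theorem aedisjoint_voronoiCell {X : Set Plane} {x y : Plane} (hx : x ∈ X) (hy : y ∈ X)
    (h : x ≠ y) : AEDisjoint volume (voronoiCell X x) (voronoiCell X y) :=
  measure_mono_null (fun _ hp => le_antisymm (hp.1 y hy) (hp.2 x hx)) (volume_setOf_dist_eq h)

/-! ### Areas of disk caps -/

/-- The part of the disk of radius `hexRadius` around `0` that is closer to `v` than to `0`. -/
def diskCap (v : Plane) : Set Plane :=
  {p | ‖p‖ ≤ hexRadius ∧ dist p v < ‖p‖}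

theorem diskCap_subset_closedBall (v : Plane) : diskCap v ⊆ Metric.closedBall 0 hexRadius :=
  fun p hp => by simpa using hp.1

theorem measurableSet_diskCap (v : Plane) : MeasurableSet (diskCap v) :=
  MeasurableSet.inter (s₁ := {p : Plane | ‖p‖ ≤ hexRadius}) (s₂ := {p : Plane | dist p v < ‖p‖})
    (isClosed_le (by fun_prop) (by fun_prop)).measurableSet
    (isOpen_lt (by fun_prop) (by fun_prop)).measurableSet

theorem volume_diskCap_ne_top (v : Plane) : volume (diskCap v) ≠ ∞ :=
  measure_ne_top_of_subset (diskCap_subset_closedBall v) (by simp [ENNReal.mul_eq_top])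

theorem mem_diskCap_iff_inner {p v : Plane} :
    p ∈ diskCap v ↔ ‖p‖ ≤ hexRadius ∧ ‖v‖ ^ 2 < 2 * inner ℝ p v := by
  rw [← dist_lt_norm_iff]; rfl

theorem mem_diskCap_iff {p v : Plane} :
    p ∈ diskCap v ↔
      p 0 ^ 2 + p 1 ^ 2 ≤ 4 / 3 ∧ v 0 ^ 2 + v 1 ^ 2 < 2 * (p 0 * v 0 + p 1 * v 1) := by
  rw [mem_diskCap_iff_inner, ← sq_le_sq₀ (norm_nonneg _) hexRadius_pos.le, hexRadius_sq,
    EuclideanSpace.real_norm_sq_eq, EuclideanSpace.real_norm_sq_eq]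
  simp [Fin.sum_univ_two, PiLp.inner_apply, mul_comm]

/-- A common point would have 0, v and w within `hexRadius`, the last two strictly, against
`not_three_points_close`. -/
theorem disjoint_diskCap {v w : Plane} (hv : 2 ≤ ‖v‖) (hw : 2 ≤ ‖w‖) (hvw : 2 ≤ dist v w) :
    Disjoint (diskCap v) (diskCap w) := by
  rw [Set.disjoint_left]
  intro p hp hp'
  exact not_three_points_close (p := p) (x := 0) (y := v) (z := w) (by simpa using hp.1)
    (hp.2.trans_le hp.1) (hp'.2.trans_le hp.1) (by simpa using hv) hvw (by simpa using hw)

/-- The reflection that exchanges v and w fixes 0 and maps one cap onto the other. -/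
theorem volume_diskCap_congr {v w : Plane} (h : ‖v‖ = ‖w‖) :
    volume (diskCap v) = volume (diskCap w) := by
  set e := Submodule.reflection (ℝ ∙ (v - w))ᗮ with he
  have hev : e v = w := Submodule.reflection_sub h
  have : diskCap v = e ⁻¹' diskCap w := by
    ext p
    rw [Set.mem_preimage, diskCap, diskCap, Set.mem_ofPred_eq, Set.mem_ofPred_eq, ← hev,
      e.norm_map, e.dist_map]
  rw [this]
  exact e.measurePreserving.measure_preimage (measurableSet_diskCap w).nullMeasurableSet

theorem norm_planeVec (x y : ℝ) : ‖(!₂[x, y] : Plane)‖ ^ 2 = x ^ 2 + y ^ 2 := by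
  rw [EuclideanSpace.real_norm_sq_eq]; simp

theorem norm_planeVec_zero {x : ℝ} (hx : 0 ≤ x) : ‖(!₂[x, 0] : Plane)‖ = x := by
  rw [← sq_eq_sq₀ (norm_nonneg _) hx, norm_planeVec]; simp

theorem volume_diskCap_lt_of_isOpen {A U : Set Plane} {v : Plane} (hA : A ⊆ diskCap v)
    (hU : U ⊆ diskCap v) (hUo : IsOpen U) (hne : U.Nonempty)
    (hd : Disjoint A U) : volume.real A < volume.real (diskCap v) := by
  have hUt : volume U ≠ ∞ := measure_ne_top_of_subset hU (volume_diskCap_ne_top v)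
  have hAt : volume A ≠ ∞ := measure_ne_top_of_subset hA (volume_diskCap_ne_top v)
  have hpos : 0 < volume.real U := ENNReal.toReal_pos (hUo.measure_pos volume hne).ne' hUt
  have h1 : volume.real (A ∪ U) ≤ volume.real (diskCap v) :=
    measureReal_mono (Set.union_subset hA hU) (volume_diskCap_ne_top v)
  rw [measureReal_union hd hUo.measurableSet hAt hUt] at h1
  linarith

/-- Once both caps are turned to the same axis, they are nested. -/
theorem volume_diskCap_le {w : Plane} (hw : 2 ≤ ‖w‖) :
    volume.real (diskCap w) ≤ volume.real (diskCap !₂[2, 0]) := by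
  have : volume (diskCap w) = volume (diskCap !₂[‖w‖, 0]) :=
    volume_diskCap_congr (norm_planeVec_zero (norm_nonneg w)).symm
  rw [measureReal_def, this, ← measureReal_def]
  refine measureReal_mono (fun p hp => ?_) (volume_diskCap_ne_top _)
  rw [mem_diskCap_iff] at hp ⊢
  simp at hp ⊢
  exact ⟨hp.1, by nlinarith [hp.2]⟩

theorem volume_diskCap_lt {w : Plane} (hw : 2 < ‖w‖) :
    volume.real (diskCap w) < volume.real (diskCap !₂[2, 0]) := by
  have : volume (diskCap w) = volume (diskCap !₂[‖w‖, 0]) :=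
    volume_diskCap_congr (norm_planeVec_zero (norm_nonneg w)).symm
  rw [measureReal_def, this, ← measureReal_def]
  -- The open set is the strip between the two bisectors, inside the disk.
  refine volume_diskCap_lt_of_isOpen
    (U := {p : Plane | p 0 ^ 2 + p 1 ^ 2 < 4 / 3 ∧ 1 < p 0 ∧ p 0 < ‖w‖ / 2})
    (fun p hp => ?_) (fun p hp => ?_) ?_ ?_ ?_
  · rw [mem_diskCap_iff] at hp ⊢
    simp at hp ⊢
    exact ⟨hp.1, by nlinarith [hp.2]⟩
  · rw [mem_diskCap_iff]
    simp
    exact ⟨hp.1.le, by linarith [hp.2.1]⟩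
  · refine IsOpen.and ?_ (IsOpen.and ?_ ?_) <;> exact isOpen_lt (by fun_prop) (by fun_prop)
  · obtain ⟨t, ht, ht'⟩ := exists_between (show (1 : ℝ) < min (‖w‖ / 2) (11 / 10) from
      lt_min (by linarith) (by norm_num))
    rw [lt_min_iff] at ht'
    refine ⟨!₂[t, 0], ?_, ?_, ?_⟩
    · simp; nlinarith
    · simpa using ht
    · simpa using ht'.1
  · rw [Set.disjoint_left]
    intro p hp hpU
    rw [mem_diskCap_iff] at hp
    simp at hp
    nlinarith [hp.2, hpU.2.2]

theorem volume_diskCap_pos : 0 < volume.real (diskCap !₂[2, 0]) := by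
  have : 2 < ‖(!₂[3, 0] : Plane)‖ := by rw [norm_planeVec_zero] <;> norm_num
  exact measureReal_nonneg.trans_lt (volume_diskCap_lt this)

/-- Two congruent caps of height corresponding to distance `√5` fit disjointly into the cap that
corresponds to distance `2`. -/
theorem two_mul_volume_diskCap_lt {w : Plane} (hw : Real.sqrt 5 ≤ ‖w‖) :
    2 * volume.real (diskCap w) < volume.real (diskCap !₂[2, 0]) := by
  have h5 : Real.sqrt 5 ^ 2 = 5 := Real.sq_sqrt (by norm_num)
  have hq : (2236 / 1000 : ℝ) < Real.sqrt 5 := by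
    rw [Real.lt_sqrt (by norm_num)]; norm_num
  set q := ‖w‖
  -- Seen from 0, the large cap spans 30° on either side of its axis, and the small ones at most
  -- about 14.5°. Their axes are tilted by ±15.2°, where 221² + 60² = 229² keeps the coordinates
  -- rational. The bound 256 lies just below 229 · √5 / 2.
  have hn : ∀ s : ℝ, s ^ 2 = (60 / 229) ^ 2 → ‖(!₂[q * (221 / 229), q * s] : Plane)‖ = ‖w‖ := by
    intro s hs
    rw [← sq_eq_sq₀ (norm_nonneg _) (norm_nonneg _), norm_planeVec, mul_pow, mul_pow, hs]
    ring
  have hmem : ∀ s : ℝ, s ^ 2 = (60 / 229) ^ 2 → ∀ p : Plane,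
      p ∈ diskCap !₂[q * (221 / 229), q * s] →
        p 0 ^ 2 + p 1 ^ 2 ≤ 4 / 3 ∧ 256 < 221 * p 0 + 229 * s * p 1 := by
    intro s hs p hp
    rw [mem_diskCap_iff] at hp
    simp at hp
    refine ⟨hp.1, ?_⟩
    have h2 := hp.2
    have h3 : q * q < q * (2 * (p 0 * (221 / 229) + p 1 * s)) := by nlinarith
    have h4 := lt_of_mul_lt_mul_left h3 (norm_nonneg w)
    linarith
  have hx : ∀ x y : ℝ, x ^ 2 + y ^ 2 ≤ 4 / 3 → 256 < 221 * x + 60 * y → 1 < x ∧ 0 < y := by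
    intro x y h1 h2
    constructor
    · by_contra! h
      have hx0 : 0 ≤ x := by nlinarith [sq_nonneg (y - 1)]
      nlinarith [sq_nonneg (x - 1), mul_nonneg hx0 (sub_nonneg.2 h)]
    · by_contra! h
      have : 256 < 221 * x := by linarith
      nlinarith [sq_nonneg y]
  have hsp : ((60 / 229 : ℝ)) ^ 2 = (60 / 229) ^ 2 := rfl
  have hsm : ((-(60 / 229) : ℝ)) ^ 2 = (60 / 229) ^ 2 := by norm_num
  set A := diskCap !₂[q * (221 / 229), q * (60 / 229)]
  set B := diskCap !₂[q * (221 / 229), q * (-(60 / 229))]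
  have hA : volume.real A = volume.real (diskCap w) := by
    rw [measureReal_def, measureReal_def, volume_diskCap_congr (hn _ hsp)]
  have hB : volume.real B = volume.real (diskCap w) := by
    rw [measureReal_def, measureReal_def, volume_diskCap_congr (hn _ hsm)]
  have hA' : ∀ p ∈ A, p 0 ^ 2 + p 1 ^ 2 ≤ 4 / 3 ∧ 256 < 221 * p 0 + 60 * p 1 := fun p hp => by
    have := hmem _ hsp p hp
    exact ⟨this.1, by linarith [this.2]⟩
  have hB' : ∀ p ∈ B, p 0 ^ 2 + p 1 ^ 2 ≤ 4 / 3 ∧ 256 < 221 * p 0 + 60 * (-p 1) := fun p hp => by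
    have := hmem _ hsm p hp
    exact ⟨this.1, by linarith [this.2]⟩
  have hdisj : Disjoint A B := by
    rw [Set.disjoint_left]
    intro p hp hp'
    have h1 := (hx _ _ (hA' p hp).1 (hA' p hp).2).2
    have h2 := (hx _ _ (by simpa using (hB' p hp').1) (hB' p hp').2).2
    linarith
  have hsub : A ∪ B ⊆ diskCap !₂[2, 0] := by
    rintro p (hp | hp) <;> rw [mem_diskCap_iff] <;> simp
    · exact ⟨(hA' p hp).1, by linarith [(hx _ _ (hA' p hp).1 (hA' p hp).2).1]⟩
    · exact ⟨(hB' p hp).1,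
        by linarith [(hx _ _ (by simpa using (hB' p hp).1) (hB' p hp).2).1]⟩
  have hlt := volume_diskCap_lt_of_isOpen
    (U := {p : Plane | p 0 ^ 2 + p 1 ^ 2 < 4 / 3 ∧ 1 < p 0 ∧ 221 * p 0 + 60 * p 1 < 256 ∧
      221 * p 0 + 60 * (-p 1) < 256}) hsub
    (fun p hp => by
      rw [mem_diskCap_iff]
      simp
      exact ⟨hp.1.le, by linarith [hp.2.1]⟩)
    (by
      refine IsOpen.and ?_ (IsOpen.and ?_ (IsOpen.and ?_ ?_)) <;>
        exact isOpen_lt (by fun_prop) (by fun_prop))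
    ⟨!₂[101 / 100, 0], by norm_num, by norm_num, by norm_num, by norm_num⟩
    (by
      rw [Set.disjoint_left]
      rintro p (hp | hp) hpU
      · linarith [(hA' p hp).2, hpU.2.2.1]
      · linarith [(hB' p hp).2, hpU.2.2.2])
  rw [measureReal_union hdisj (measurableSet_diskCap _) (volume_diskCap_ne_top _)
    (volume_diskCap_ne_top _), hA, hB] at hlt
  linarith

/-! ### Polar angles and angular gaps -/

/-- The plane as the complex numbers. -/
noncomputable def planeToComplex : Plane ≃ₗᵢ[ℝ] ℂ := Complex.orthonormalBasisOneI.repr.symm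

/-- Rotation of the plane by 60 degrees. -/
noncomputable def rotateSixty (v : Plane) : Plane :=
  planeToComplex.symm (Complex.exp ((Real.pi / 3 : ℝ) * Complex.I) * planeToComplex v)

/-- `t` measures the counterclockwise angle from `v₀`. -/
def IsPolarAngle (v₀ : Plane) (t : Plane → ℝ) : Prop :=
  t v₀ = 0 ∧ ∀ v, 0 ≤ t v ∧ t v < 2 * Real.pi ∧
    planeToComplex v =
      ((‖v‖ / ‖v₀‖ : ℝ) : ℂ) * Complex.exp (t v * Complex.I) * planeToComplex v₀

theorem exists_isPolarAngle {v₀ : Plane} (h : v₀ ≠ 0) : ∃ t, IsPolarAngle v₀ t := by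
  have hz : planeToComplex v₀ ≠ 0 := by simpa using h
  refine ⟨fun v => toIcoMod Real.two_pi_pos 0 (planeToComplex v / planeToComplex v₀).arg, ?_,
    fun v => ⟨left_le_toIcoMod _ _ _, ?_, ?_⟩⟩
  · simp [div_self hz]
  · simpa using toIcoMod_lt_right Real.two_pi_pos 0 (planeToComplex v / planeToComplex v₀).arg
  · have h1 : Complex.exp ((toIcoMod Real.two_pi_pos 0
        (planeToComplex v / planeToComplex v₀).arg : ℝ) * Complex.I) =
        Complex.exp ((planeToComplex v / planeToComplex v₀).arg * Complex.I) := by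
      rw [Complex.exp_eq_exp_iff_exists_int]
      refine ⟨-toIcoDiv Real.two_pi_pos 0 (planeToComplex v / planeToComplex v₀).arg, ?_⟩
      rw [toIcoMod]
      push_cast
      simp
      ring
    have h2 := Complex.norm_mul_exp_arg_mul_I (planeToComplex v / planeToComplex v₀)
    rw [norm_div, LinearIsometryEquiv.norm_map, LinearIsometryEquiv.norm_map] at h2
    rw [h1, h2, div_mul_cancel₀ _ hz]

theorem IsPolarAngle.inner_eq {v₀ : Plane} {t : Plane → ℝ} (ht : IsPolarAngle v₀ t) (h : v₀ ≠ 0)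
    (v w : Plane) : inner ℝ v w = Real.cos (t v - t w) * (‖v‖ * ‖w‖) := by
  have hn : ‖v₀‖ ≠ 0 := by simpa using h
  have hz : Complex.normSq (planeToComplex v₀) = ‖v₀‖ ^ 2 := by
    rw [Complex.normSq_eq_norm_sq, LinearIsometryEquiv.norm_map]
  rw [Complex.normSq_apply] at hz
  rw [← planeToComplex.inner_map_map v w, Complex.inner, (ht.2 v).2.2, (ht.2 w).2.2, Real.cos_sub]
  have e : ∀ s : ℝ, Complex.exp (s * Complex.I) = ⟨Real.cos s, Real.sin s⟩ := by
    intro s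
    apply Complex.ext
    · rw [Complex.exp_ofReal_mul_I_re]
    · rw [Complex.exp_ofReal_mul_I_im]
  rw [e, e]
  simp only [map_mul, Complex.mul_re, Complex.mul_im, Complex.conj_re, Complex.conj_im,
    Complex.ofReal_re, Complex.ofReal_im, zero_mul, sub_zero, add_zero]
  set a := (planeToComplex v₀).re
  set b := (planeToComplex v₀).im
  field_simp
  rw [← hz]
  ring

theorem gap_of_cos_le {s w : ℝ} (hw : w ≤ Real.pi) (hs : |s| < 2 * Real.pi)
    (h : Real.cos s ≤ Real.cos w) : w ≤ |s| ∧ |s| ≤ 2 * Real.pi - w := by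
  rw [← Real.cos_abs] at h
  constructor
  · by_contra! hlt
    exact absurd h (not_le.2 (Real.cos_lt_cos_of_nonneg_of_le_pi (abs_nonneg s) hw hlt))
  · by_contra! hlt
    rw [← Real.cos_two_pi_sub] at h
    exact absurd h (not_le.2 (Real.cos_lt_cos_of_nonneg_of_le_pi (by linarith) hw (by linarith)))

/-- Removing the largest value and recursing plays the role of sorting. The clause that y is maximal
drives the induction. -/
theorem Finset.exists_spread {α : Type*} [DecidableEq α] (t : α → ℝ) {w : ℝ} (n : ℕ) :
    ∀ T : Finset α, T.card = n + 1 → (∀ x ∈ T, ∀ y ∈ T, x ≠ y → w ≤ |t x - t y|) →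
      ∃ x ∈ T, ∃ y ∈ T, t x + n * w ≤ t y ∧ ∀ z ∈ T, t z ≤ t y := by
  induction n with
  | zero =>
    intro T hT _
    obtain ⟨x, rfl⟩ := Finset.card_eq_one.1 hT
    exact ⟨x, by simp, x, by simp, by simp, by simp⟩
  | succ n ih =>
    intro T hT hgap
    obtain ⟨y, hy, hmax⟩ := T.exists_max_image t (Finset.card_pos.1 (by omega))
    obtain ⟨x, hx, y', hy', h1, -⟩ := ih (T.erase y) (by rw [Finset.card_erase_of_mem hy]; omega)
      (fun a ha b hb => hgap a (Finset.mem_of_mem_erase ha) b (Finset.mem_of_mem_erase hb))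
    refine ⟨x, Finset.mem_of_mem_erase hx, y, hy, ?_, hmax⟩
    have h2 := hgap y hy y' (Finset.mem_of_mem_erase hy') (Finset.ne_of_mem_erase hy').symm
    rw [abs_of_nonneg (sub_nonneg.2 (hmax y' (Finset.mem_of_mem_erase hy')))] at h2
    push_cast
    linarith

/-- By the law of cosines, the angle at 0 is smallest in the isosceles triangle with legs √m and
base 2, whose cosine is (2m - 4) / (2m). -/
theorem inner_le_of_two_le_dist {v w : Plane} {m : ℝ} (hv : 2 ≤ ‖v‖) (hw : 2 ≤ ‖w‖)
    (hvm : ‖v‖ ^ 2 ≤ m) (hwm : ‖w‖ ^ 2 ≤ m) (hm : m ≤ 6) (h : 2 ≤ dist v w) :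
    inner ℝ v w ≤ (m - 2) / m * (‖v‖ * ‖w‖) := by
  have key : ∀ x y : ℝ, 2 ≤ x → x ≤ y → y ^ 2 ≤ m →
      m * (x ^ 2 + y ^ 2 - 4) ≤ (2 * m - 4) * (x * y) := by
    intro x y hx hxy hy
    have h3 : m * (y - x) ≤ 4 * y := by nlinarith
    nlinarith [mul_nonneg (sub_nonneg.2 hxy) (sub_nonneg.2 h3)]
  have hm0 : 0 < m := by nlinarith
  have hd : 4 ≤ dist v w ^ 2 := by nlinarith
  rw [dist_sq_eq_inner] at hd
  have h4 : m * (‖v‖ ^ 2 + ‖w‖ ^ 2 - 4) ≤ (2 * m - 4) * (‖v‖ * ‖w‖) := by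
    rcases le_total ‖v‖ ‖w‖ with h5 | h5
    · exact key _ _ hv h5 hwm
    · have := key _ _ hw h5 hvm
      linarith
  rw [div_mul_eq_mul_div, le_div_iff₀ hm0]
  nlinarith

/-- Points around `0` with prescribed minimal angles between them. The angle to the points adjacent
to `v₀` is at least `u`, all other angles are at least `w`. -/
theorem angles_of_inner_le {F : Finset Plane} {v₀ : Plane} {t : Plane → ℝ}
    (ht : IsPolarAngle v₀ t) (h0 : ∀ v ∈ F, v ≠ 0) (hv₀ : v₀ ∈ F) {n : ℕ} (hcard : F.card = n + 2)
    {u w : ℝ} (hu : u ≤ Real.pi) (hw : w ≤ Real.pi)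
    (hFu : ∀ v ∈ F, v ≠ v₀ → inner ℝ v v₀ ≤ Real.cos u * (‖v‖ * ‖v₀‖))
    (hFw : ∀ v ∈ F, v ≠ v₀ → ∀ v' ∈ F, v' ≠ v₀ → v ≠ v' →
      inner ℝ v v' ≤ Real.cos w * (‖v‖ * ‖v'‖)) :
    ∃ x ∈ F, x ≠ v₀ ∧ u ≤ t x ∧ t x + n * w ≤ 2 * Real.pi - u := by
  classical
  have hpos : ∀ v ∈ F, ∀ v' ∈ F, 0 < ‖v‖ * ‖v'‖ := fun v hv v' hv' =>
    mul_pos (norm_pos_iff.2 (h0 v hv)) (norm_pos_iff.2 (h0 v' hv'))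
  have hlt : ∀ v v', |t v - t v'| < 2 * Real.pi := fun v v' => by
    rw [abs_lt]
    have h1 := ht.2 v
    have h2 := ht.2 v'
    constructor <;> linarith
  have hbase : ∀ v ∈ F, v ≠ v₀ → u ≤ t v ∧ t v ≤ 2 * Real.pi - u := by
    intro v hv hne
    have h1 := hFu v hv hne
    rw [ht.inner_eq (h0 _ hv₀)] at h1
    have h2 := gap_of_cos_le hu (hlt v v₀) (le_of_mul_le_mul_right h1 (hpos v hv v₀ hv₀))
    rwa [ht.1, sub_zero, abs_of_nonneg (ht.2 v).1] at h2
  obtain ⟨x, hx, y, hy, hxy, -⟩ := Finset.exists_spread t (w := w) n (F.erase v₀)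
    (by rw [Finset.card_erase_of_mem hv₀]; omega) (by
      intro v hv v' hv' hne
      rw [Finset.mem_erase] at hv hv'
      have h1 := hFw v hv.2 hv.1 v' hv'.2 hv'.1 hne
      rw [ht.inner_eq (h0 _ hv₀)] at h1
      exact (gap_of_cos_le hw (hlt v v')
        (le_of_mul_le_mul_right h1 (hpos v hv.2 v' hv'.2))).1)
  rw [Finset.mem_erase] at hx hy
  exact ⟨x, hx.2, hx.1, (hbase x hx.2 hx.1).1, hxy.trans (hbase y hy.2 hy.1).2⟩

/-! ### Number of near neighbours and total area of their caps -/

theorem five_eighths_le_cos : 5 / 8 ≤ Real.cos (28 / 100 * Real.pi) := by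
  -- The quadratic bound is too weak at the full angle, so it is applied at half the angle and
  -- doubled.
  have h1 := Real.one_sub_sq_div_two_le_cos (x := 14 / 100 * Real.pi)
  have h2 := Real.pi_lt_d4
  have h3 := Real.pi_gt_three
  have h4 : (902 / 1000 : ℝ) ≤ Real.cos (14 / 100 * Real.pi) := by nlinarith
  rw [show 28 / 100 * Real.pi = 2 * (14 / 100 * Real.pi) by ring, Real.cos_two_mul]
  nlinarith

theorem three_fifths_le_cos : 3 / 5 ≤ Real.cos (29 / 100 * Real.pi) := by
  have h1 := Real.one_sub_sq_div_two_le_cos (x := 145 / 1000 * Real.pi)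
  have h2 := Real.pi_lt_d4
  have h3 := Real.pi_gt_three
  have h4 : (895 / 1000 : ℝ) ≤ Real.cos (145 / 1000 * Real.pi) := by nlinarith
  rw [show 29 / 100 * Real.pi = 2 * (145 / 1000 * Real.pi) by ring, Real.cos_two_mul]
  nlinarith

/-- A finite set of points in an annulus around `0`, with mutual distances at least `2`; these are
the points whose bisectors with `0` meet the disk of radius `hexRadius`. -/
structure IsNearPacking (F : Finset Plane) : Prop where
  two_le_norm : ∀ v ∈ F, 2 ≤ ‖v‖
  norm_lt : ∀ v ∈ F, ‖v‖ < 2 * hexRadius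
  two_le_dist : ∀ v ∈ F, ∀ w ∈ F, v ≠ w → 2 ≤ dist v w

namespace IsNearPacking

variable {F : Finset Plane}

theorem mono {G : Finset Plane} (h : IsNearPacking F) (hG : G ⊆ F) : IsNearPacking G where
  two_le_norm v hv := h.two_le_norm v (hG hv)
  norm_lt v hv := h.norm_lt v (hG hv)
  two_le_dist v hv w hw := h.two_le_dist v (hG hv) w (hG hw)

theorem ne_zero (h : IsNearPacking F) : ∀ v ∈ F, v ≠ 0 := fun v hv => by
  have := h.two_le_norm v hv
  rw [← norm_pos_iff]
  linarith

/-- The bound is (2 * `hexRadius`)². It turns (m - 2) / m into 5/8, the constant of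
`five_eighths_le_cos`. -/
theorem norm_sq_le (h : IsNearPacking F) : ∀ v ∈ F, ‖v‖ ^ 2 ≤ 16 / 3 := fun v hv => by
  have h1 := h.norm_lt v hv
  have h2 := hexRadius_sq
  nlinarith [norm_nonneg v]

theorem inner_le (h : IsNearPacking F) {v w : Plane} (hv : v ∈ F) (hw : w ∈ F) (hne : v ≠ w) :
    inner ℝ v w ≤ Real.cos (28 / 100 * Real.pi) * (‖v‖ * ‖w‖) := by
  refine (inner_le_of_two_le_dist (h.two_le_norm v hv) (h.two_le_norm w hw) (h.norm_sq_le v hv)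
    (h.norm_sq_le w hw) (by norm_num) (h.two_le_dist v hv w hw hne)).trans ?_
  gcongr
  exact le_trans (by norm_num) five_eighths_le_cos

theorem inner_le_of_norm_le (h : IsNearPacking F) {v w : Plane} (hv : v ∈ F) (hw : w ∈ F)
    (hne : v ≠ w) (hv' : ‖v‖ < Real.sqrt 5) (hw' : ‖w‖ < Real.sqrt 5) :
    inner ℝ v w ≤ Real.cos (29 / 100 * Real.pi) * (‖v‖ * ‖w‖) := by
  have h5 : Real.sqrt 5 ^ 2 = 5 := Real.sq_sqrt (by norm_num)
  refine (inner_le_of_two_le_dist (m := 5) (h.two_le_norm v hv) (h.two_le_norm w hw)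
    (by rw [← h5]; gcongr) (by rw [← h5]; gcongr) (by norm_num)
    (h.two_le_dist v hv w hw hne)).trans ?_
  gcongr
  exact le_trans (by norm_num) three_fifths_le_cos

/-- Eight gaps of at least 0.28π exceed 2π. -/
theorem card_le_seven (h : IsNearPacking F) : F.card ≤ 7 := by
  by_contra! hc
  obtain ⟨G, hGF, hG⟩ := Finset.exists_subset_card_eq (show 8 ≤ F.card by omega)
  have hGp := h.mono hGF
  obtain ⟨v₀, hv₀⟩ := Finset.card_pos.1 (show 0 < G.card by omega)
  obtain ⟨t, ht⟩ := exists_isPolarAngle (hGp.ne_zero v₀ hv₀)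
  have hpi := Real.pi_pos
  obtain ⟨x, -, -, h1, h2⟩ := angles_of_inner_le ht hGp.ne_zero hv₀ (n := 6) hG
    (u := 28 / 100 * Real.pi) (w := 28 / 100 * Real.pi) (by linarith) (by linarith)
    (fun v hv hne => hGp.inner_le hv hv₀ hne)
    (fun v hv _ v' hv' _ hne => hGp.inner_le hv hv' hne)
  push_cast at h2
  linarith

/-- Only the two gaps next to `v₀` can be as small as 0.28π. The other five are at least 0.29π, and
2 · 0.28 + 5 · 0.29 = 2.01 > 2. -/
theorem card_ne_seven (h : IsNearPacking F) {v₀ : Plane} (hv₀ : v₀ ∈ F)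
    (hsmall : ∀ v ∈ F, v ≠ v₀ → ‖v‖ < Real.sqrt 5) : F.card ≠ 7 := by
  intro hc
  obtain ⟨t, ht⟩ := exists_isPolarAngle (h.ne_zero v₀ hv₀)
  have hpi := Real.pi_pos
  obtain ⟨x, -, -, h1, h2⟩ := angles_of_inner_le ht h.ne_zero hv₀ (n := 5) hc
    (u := 28 / 100 * Real.pi) (w := 29 / 100 * Real.pi) (by linarith) (by linarith)
    (fun v hv hne => h.inner_le hv hv₀ hne)
    (fun v hv hv1 v' hv' hv1' hne =>
      h.inner_le_of_norm_le hv hv' hne (hsmall v hv hv1) (hsmall v' hv' hv1'))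
  push_cast at h2
  linarith

/-- Six gaps of at least 60° fill the circle exactly, so the first point after `v₀` is at exactly
60°. -/
theorem rotateSixty_mem (h : IsNearPacking F) (hc : F.card = 6) (h2 : ∀ v ∈ F, ‖v‖ = 2)
    {v₀ : Plane} (hv₀ : v₀ ∈ F) : rotateSixty v₀ ∈ F := by
  obtain ⟨t, ht⟩ := exists_isPolarAngle (h.ne_zero v₀ hv₀)
  have hpi := Real.pi_pos
  have hin : ∀ v ∈ F, ∀ w ∈ F, v ≠ w →
      inner ℝ v w ≤ Real.cos (Real.pi / 3) * (‖v‖ * ‖w‖) := by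
    intro v hv w hw hne
    refine (inner_le_of_two_le_dist (m := 4) (h.two_le_norm v hv) (h.two_le_norm w hw)
      (by rw [h2 v hv]; norm_num) (by rw [h2 w hw]; norm_num) (by norm_num)
      (h.two_le_dist v hv w hw hne)).trans ?_
    rw [Real.cos_pi_div_three]
    norm_num
  obtain ⟨x, hx, -, h3, h4⟩ := angles_of_inner_le ht h.ne_zero hv₀ (n := 4) hc
    (u := Real.pi / 3) (w := Real.pi / 3) (by linarith) (by linarith)
    (fun v hv hne => hin v hv v₀ hv₀ hne)
    (fun v hv _ v' hv' _ hne => hin v hv v' hv' hne)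
  push_cast at h4
  have h5 : t x = Real.pi / 3 := by linarith
  have h6 := (ht.2 x).2.2
  rw [h5, h2 x hx, h2 v₀ hv₀] at h6
  have : rotateSixty v₀ = x := by
    rw [rotateSixty, LinearIsometryEquiv.symm_apply_eq, h6]
    simp
  rwa [this]

theorem sum_volume_diskCap_le (h : IsNearPacking F) :
    ∑ v ∈ F, volume.real (diskCap v) ≤ 6 * volume.real (diskCap !₂[2, 0]) ∧
    (6 * volume.real (diskCap !₂[2, 0]) ≤ ∑ v ∈ F, volume.real (diskCap v) →
      F.card = 6 ∧ ∀ v ∈ F, ‖v‖ = 2) := by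
  classical
  set s := volume.real (diskCap !₂[2, 0]) with hs
  have hs0 : 0 < s := volume_diskCap_pos
  have hle : ∀ v ∈ F, volume.real (diskCap v) ≤ s := fun v hv =>
    volume_diskCap_le (h.two_le_norm v hv)
  have hsum : ∀ G ⊆ F, ∑ v ∈ G, volume.real (diskCap v) ≤ G.card * s := fun G hG => by
    rw [← nsmul_eq_mul]
    exact Finset.sum_le_card_nsmul _ _ _ fun v hv => hle v (hG hv)
  have h7 := h.card_le_seven
  have hF := hsum F subset_rfl
  rcases Nat.lt_or_ge F.card 6 with hc | hc
  · have : (F.card : ℝ) ≤ 5 := by exact_mod_cast Nat.lt_succ_iff.1 hc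
    have : (F.card : ℝ) * s ≤ 5 * s := by gcongr
    exact ⟨by linarith, fun hh => by linarith⟩
  rcases hc.eq_or_lt with hc | hc
  · rw [← hc] at hF
    push_cast at hF
    refine ⟨hF, fun hh => ⟨hc.symm, fun v hv => ?_⟩⟩
    by_contra hne
    have hlt := volume_diskCap_lt (lt_of_le_of_ne (h.two_le_norm v hv) (Ne.symm hne))
    have h1 := hsum (F.erase v) (Finset.erase_subset _ _)
    rw [Finset.card_erase_of_mem hv, ← hc] at h1
    rw [← Finset.add_sum_erase F _ hv] at hh
    push_cast at h1
    linarith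
  · have hc7 : F.card = 7 := by omega
    obtain ⟨v₁, hv₁⟩ := Finset.card_pos.1 (show 0 < F.card by omega)
    -- Whichever point is set aside, another one has norm at least √5. Two applications yield two
    -- distinct far points, whose caps together are smaller than one full cap.
    have hlarge : ∀ v₀ ∈ F, ∃ v ∈ F, v ≠ v₀ ∧ Real.sqrt 5 ≤ ‖v‖ := by
      intro v₀ hv₀
      by_contra! hcon
      exact h.card_ne_seven hv₀ (fun v hv hne => hcon v hv hne) hc7
    obtain ⟨v, hv, -, hvl⟩ := hlarge v₁ hv₁
    obtain ⟨w, hw, hwv, hwl⟩ := hlarge v hv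
    have hw' : w ∈ F.erase v := Finset.mem_erase.2 ⟨hwv, hw⟩
    have h1 := hsum ((F.erase v).erase w)
      ((Finset.erase_subset _ _).trans (Finset.erase_subset _ _))
    rw [Finset.card_erase_of_mem hw', Finset.card_erase_of_mem hv, hc7] at h1
    have h2 := two_mul_volume_diskCap_lt hvl
    have h3 := two_mul_volume_diskCap_lt hwl
    rw [← Finset.add_sum_erase F _ hv, ← Finset.add_sum_erase (F.erase v) _ hw']
    push_cast at h1
    constructor
    · linarith
    · intro hh
      linarith

end IsNearPacking

/-! ### The hexagonal lattice and its Voronoi cell -/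

/-- Two vectors of length `2` that enclose an angle of 60 degrees. -/
structure IsHexPair (a b : Plane) : Prop where
  norm_left : ‖a‖ = 2
  norm_right : ‖b‖ = 2
  inner_eq : inner ℝ a b = 2

/-- The translate by `c` of the lattice spanned by `a` and `b`. -/
def latticeTranslate (c a b : Plane) : Set Plane :=
  {p | ∃ m n : ℤ, p = c + (m : ℝ) • a + (n : ℝ) • b}

namespace IsHexPair

variable {a b : Plane}

theorem norm_sq (h : IsHexPair a b) (x y : ℝ) :
    ‖x • a + y • b‖ ^ 2 = 4 * (x ^ 2 + x * y + y ^ 2) := by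
  rw [norm_add_sq_real, norm_smul, norm_smul, real_inner_smul_left, real_inner_smul_right,
    h.norm_left, h.norm_right, h.inner_eq, Real.norm_eq_abs, Real.norm_eq_abs, mul_pow, mul_pow,
    sq_abs, sq_abs]
  ring

theorem linearIndependent (h : IsHexPair a b) : LinearIndependent ℝ ![a, b] := by
  rw [LinearIndependent.pair_iff]
  intro x y hxy
  have h1 := h.norm_sq x y
  rw [hxy, norm_zero] at h1
  constructor <;> nlinarith [sq_nonneg (x + y), sq_nonneg x, sq_nonneg y]

/-- The basis of the plane given by a hexagonal pair. -/
noncomputable def basis (h : IsHexPair a b) : Module.Basis (Fin 2) ℝ Plane :=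
  basisOfLinearIndependentOfCardEqFinrank h.linearIndependent (by simp)

theorem coe_basis (h : IsHexPair a b) : ⇑h.basis = ![a, b] :=
  coe_basisOfLinearIndependentOfCardEqFinrank _ _

theorem exists_coord (h : IsHexPair a b) (p : Plane) : ∃ x y : ℝ, p = x • a + y • b := by
  refine ⟨h.basis.repr p 0, h.basis.repr p 1, ?_⟩
  conv_lhs => rw [← h.basis.sum_repr p]
  simp [Fin.sum_univ_two, h.coe_basis]

theorem det_basis_sq (h : IsHexPair a b) :
    (EuclideanSpace.basisFun (Fin 2) ℝ).toBasis.det h.basis ^ 2 = 12 := by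
  have h1 : ‖a‖ ^ 2 = 4 := by rw [h.norm_left]; norm_num
  have h2 : ‖b‖ ^ 2 = 4 := by rw [h.norm_right]; norm_num
  have h3 := h.inner_eq
  rw [EuclideanSpace.real_norm_sq_eq, Fin.sum_univ_two] at h1 h2
  simp only [PiLp.inner_apply, Fin.sum_univ_two] at h3
  simp at h3
  rw [Module.Basis.det_apply, Matrix.det_fin_two, h.coe_basis]
  simp [Module.Basis.toMatrix_apply]
  have h4 : (a 0 * b 0 + a 1 * b 1) ^ 2 = 4 := by
    rw [mul_comm (a 0), mul_comm (a 1), h3]; norm_num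
  have h5 : (a 0 ^ 2 + a 1 ^ 2) * (b 0 ^ 2 + b 1 ^ 2) = 16 := by rw [h1, h2]; norm_num
  linear_combination h5 - h4

theorem volume_fundamentalDomain (h : IsHexPair a b) :
    volume (ZSpan.fundamentalDomain h.basis) = ENNReal.ofReal (2 * Real.sqrt 3) := by
  have h1 : volume (ZSpan.fundamentalDomain (EuclideanSpace.basisFun (Fin 2) ℝ).toBasis) = 1 := by
    rw [measure_congr (ZSpan.fundamentalDomain_ae_parallelepiped _ volume)]
    simpa using (EuclideanSpace.basisFun (Fin 2) ℝ).volume_parallelepiped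
  rw [ZSpan.measure_fundamentalDomain _ _ (EuclideanSpace.basisFun (Fin 2) ℝ).toBasis, h1, mul_one]
  congr 1
  rw [← sq_eq_sq₀ (abs_nonneg _) (by positivity), sq_abs, h.det_basis_sq, mul_pow,
    Real.sq_sqrt (by norm_num)]
  norm_num

theorem mem_span_iff (h : IsHexPair a b) {p : Plane} :
    p ∈ Submodule.span ℤ (Set.range h.basis) ↔ ∃ m n : ℤ, p = (m : ℝ) • a + (n : ℝ) • b := by
  rw [h.coe_basis, Matrix.range_cons, Matrix.range_cons, Matrix.range_empty, Set.union_empty,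
    Set.singleton_union, Submodule.mem_span_pair]
  simp only [Int.cast_smul_eq_zsmul, eq_comm]

theorem mem_latticeTranslate_iff (h : IsHexPair a b) {c p : Plane} :
    p ∈ latticeTranslate c a b ↔ p - c ∈ Submodule.span ℤ (Set.range h.basis) := by
  rw [h.mem_span_iff]
  simp only [latticeTranslate, Set.mem_ofPred_eq, sub_eq_iff_eq_add', add_assoc]

theorem two_le_norm (h : IsHexPair a b) {m n : ℤ} (hmn : 1 ≤ m ^ 2 + m * n + n ^ 2) :
    2 ≤ ‖(m : ℝ) • a + (n : ℝ) • b‖ := by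
  have h1 := h.norm_sq m n
  have h2 : (1 : ℝ) ≤ (m : ℝ) ^ 2 + m * n + n ^ 2 := by exact_mod_cast hmn
  nlinarith [norm_nonneg ((m : ℝ) • a + (n : ℝ) • b)]

theorem isCirclePacking (h : IsHexPair a b) (c : Plane) :
    IsCirclePacking (latticeTranslate c a b) := by
  rintro _ ⟨m, n, rfl⟩ _ ⟨m', n', rfl⟩ hne
  have e : c + (m : ℝ) • a + (n : ℝ) • b - (c + (m' : ℝ) • a + (n' : ℝ) • b) =
      ((m - m' : ℤ) : ℝ) • a + ((n - n' : ℤ) : ℝ) • b := by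
    push_cast
    module
  rw [dist_eq_norm, e]
  refine h.two_le_norm ?_
  by_contra! hlt
  have h1 : m - m' = 0 := by
    nlinarith [sq_nonneg (m - m' + (n - n')), sq_nonneg (m - m'), sq_nonneg (n - n')]
  have h2 : n - n' = 0 := by
    nlinarith [sq_nonneg (m - m' + (n - n')), sq_nonneg (m - m'), sq_nonneg (n - n')]
  rw [h1, h2] at e
  exact hne (sub_eq_zero.1 (by simpa using e))

theorem self_mem (c a b : Plane) : c ∈ latticeTranslate c a b := ⟨0, 0, by simp⟩

theorem latticeTranslate_eq (h : IsHexPair a b) {c x : Plane} (hx : x ∈ latticeTranslate c a b) :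
    latticeTranslate c a b = latticeTranslate x a b := by
  ext p
  rw [h.mem_latticeTranslate_iff] at hx
  rw [h.mem_latticeTranslate_iff, h.mem_latticeTranslate_iff, ← sub_sub_sub_cancel_right p x c]
  exact ((Submodule.sub_mem_iff_left _ hx)).symm

theorem voronoiCell_subset (h : IsHexPair a b) (c : Plane) :
    voronoiCell (latticeTranslate c a b) c ⊆ Metric.closedBall c hexRadius := by
  intro p hp
  obtain ⟨x, y, hxy⟩ := h.exists_coord (p - c)
  have key : ∀ m n : ℤ, x * (2 * m + n) + y * (m + 2 * n) ≤ m ^ 2 + m * n + n ^ 2 := by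
    intro m n
    have h1 := hp _ ⟨m, n, rfl⟩
    have h2 : dist p (c + (m : ℝ) • a + (n : ℝ) • b) = ‖(x - m) • a + (y - n) • b‖ := by
      rw [dist_eq_norm]
      congr 1
      rw [← sub_add_cancel p c, hxy]
      module
    rw [h2, dist_eq_norm, hxy, ← sq_le_sq₀ (norm_nonneg _) (norm_nonneg _), h.norm_sq,
      h.norm_sq] at h1
    linarith
  have k1 := key 1 0
  have k2 := key 0 1
  have k3 := key (-1) 1
  have k4 := key (-1) 0
  have k5 := key 0 (-1)
  have k6 := key 1 (-1)
  push_cast at k1 k2 k3 k4 k5 k6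
  rw [Metric.mem_closedBall, dist_eq_norm, hxy, ← sq_le_sq₀ (norm_nonneg _) hexRadius_pos.le,
    h.norm_sq, hexRadius_sq]
  -- The six nearest lattice points bound A = 2x + y, B = x + 2y and C = x - y by 1 in absolute
  -- value. Here A = B + C and 3(x² + xy + y²) = A² - AB + B² = A² - AC + C² = B² + BC + C². A case
  -- split on signs selects the form that is at most 1.
  have a1 : (2 * x + y) ^ 2 ≤ 1 := by nlinarith
  have a2 : (x + 2 * y) ^ 2 ≤ 1 := by nlinarith
  have a3 : (x - y) ^ 2 ≤ 1 := by nlinarith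
  rcases le_total 0 ((x + 2 * y) * (x - y)) with c1 | c1
  · nlinarith
  · rcases le_total 0 ((2 * x + y) * (x + 2 * y)) with c2 | c2
    · nlinarith
    · rcases le_total 0 ((2 * x + y) * (x - y)) with c3 | c3
      · nlinarith
      · nlinarith

theorem voronoiCell_subset_of_mem (h : IsHexPair a b) {c x : Plane}
    (hx : x ∈ latticeTranslate c a b) :
    voronoiCell (latticeTranslate c a b) x ⊆ Metric.closedBall x hexRadius := by
  rw [h.latticeTranslate_eq hx]
  exact h.voronoiCell_subset x

theorem exists_dist_le (h : IsHexPair a b) (c p : Plane) :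
    ∃ x ∈ latticeTranslate c a b, dist p x ≤ hexRadius := by
  obtain ⟨x, hx, hp⟩ := (h.isCirclePacking c).exists_mem_voronoiCell ⟨c, self_mem c a b⟩ p
  exact ⟨x, hx, h.voronoiCell_subset_of_mem hx hp⟩

theorem add_mem_voronoiCell_iff (h : IsHexPair a b) {c g p : Plane}
    (hg : g ∈ Submodule.span ℤ (Set.range h.basis)) :
    g + p ∈ voronoiCell (latticeTranslate c a b) (g + c) ↔
      p ∈ voronoiCell (latticeTranslate c a b) c := by
  constructor
  · intro hp y hy
    have := hp (g + y) (by
      rw [h.mem_latticeTranslate_iff] at hy ⊢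
      rw [add_sub_assoc]
      exact add_mem hg hy)
    simpa using this
  · intro hp y hy
    have := hp (y - g) (by
      rw [h.mem_latticeTranslate_iff] at hy ⊢
      rw [sub_right_comm]
      exact sub_mem hy hg)
    rwa [dist_add_left, ← sub_add_cancel y g, add_comm (y - g) g, dist_add_left]

open scoped Pointwise in
theorem isAddFundamentalDomain (h : IsHexPair a b) (c : Plane) :
    IsAddFundamentalDomain (Submodule.span ℤ (Set.range h.basis)).toAddSubgroup
      (voronoiCell (latticeTranslate c a b) c) volume where
  nullMeasurableSet := (isClosed_voronoiCell _ _).measurableSet.nullMeasurableSet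
  ae_covers := by
    refine Eventually.of_forall fun p => ?_
    obtain ⟨x, hx, hp⟩ := (h.isCirclePacking c).exists_mem_voronoiCell ⟨c, self_mem c a b⟩ p
    rw [h.mem_latticeTranslate_iff] at hx
    refine ⟨⟨-(x - c), neg_mem hx⟩, ?_⟩
    rw [AddSubgroup.vadd_def, vadd_eq_add, ← h.add_mem_voronoiCell_iff hx]
    simpa [← add_assoc] using hp
  aedisjoint := by
    have e : ∀ g : (Submodule.span ℤ (Set.range h.basis)).toAddSubgroup,
        g +ᵥ voronoiCell (latticeTranslate c a b) c ⊆
          voronoiCell (latticeTranslate c a b) (g + c) := by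
      rintro g _ ⟨p, hp, rfl⟩
      exact (h.add_mem_voronoiCell_iff g.2).2 hp
    intro g g' hne
    have hm : ∀ g : (Submodule.span ℤ (Set.range h.basis)).toAddSubgroup,
        (g : Plane) + c ∈ latticeTranslate c a b := fun g => by
      rw [h.mem_latticeTranslate_iff, add_sub_cancel_right]
      exact g.2
    exact (aedisjoint_voronoiCell (hm g) (hm g') (by simpa using hne)).mono (e g) (e g')

/-- The cell and the parallelogram spanned by a and b are both fundamental domains of the lattice,
so their areas agree. -/
theorem volume_voronoiCell (h : IsHexPair a b) {c x : Plane} (hx : x ∈ latticeTranslate c a b) :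
    volume (voronoiCell (latticeTranslate c a b) x) = ENNReal.ofReal (2 * Real.sqrt 3) := by
  have : Countable (Submodule.span ℤ (Set.range h.basis)).toAddSubgroup :=
    (inferInstance : Countable (Submodule.span ℤ (Set.range h.basis)))
  rw [h.latticeTranslate_eq hx, ← h.volume_fundamentalDomain]
  exact (h.isAddFundamentalDomain x).measure_eq (ZSpan.isAddFundamentalDomain' h.basis volume)

/-- The Voronoi hexagon and the caps of its six neighbours are disjoint subsets of the disk. This
evaluates the extremal case without computing the area of a cap. -/
theorem volume_diskCap_le (h : IsHexPair a b) :
    2 * Real.sqrt 3 + 6 * volume.real (diskCap !₂[2, 0]) ≤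
      volume.real (Metric.closedBall (0 : Plane) hexRadius) := by
  -- Lattice coordinates of the six nearest neighbours of 0.
  set M : Fin 6 → ℤ := ![1, 0, -1, -1, 0, 1]
  set N : Fin 6 → ℤ := ![0, 1, 1, 0, -1, -1]
  set f : Fin 6 → Plane := fun i => (M i : ℝ) • a + (N i : ℝ) • b with hf
  set V := voronoiCell (latticeTranslate 0 a b) 0 with hV
  have hnorm : ∀ i, ‖f i‖ = 2 := fun i => by
    rw [← sq_eq_sq₀ (norm_nonneg _) (by norm_num), hf, h.norm_sq]
    have : (M i) ^ 2 + M i * N i + (N i) ^ 2 = 1 := by revert i; decide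
    have : ((M i : ℝ)) ^ 2 + M i * N i + (N i : ℝ) ^ 2 = 1 := by exact_mod_cast this
    rw [this]
    norm_num
  have hdist : ∀ i j, i ≠ j → 2 ≤ dist (f i) (f j) := fun i j hij => by
    have e : f i - f j = ((M i - M j : ℤ) : ℝ) • a + ((N i - N j : ℤ) : ℝ) • b := by
      simp only [hf]
      push_cast
      module
    rw [dist_eq_norm, e]
    refine h.two_le_norm ?_
    clear e
    revert i j
    decide
  have hdisj : Pairwise (Function.onFun Disjoint fun i => diskCap (f i)) := fun i j hij =>
    disjoint_diskCap (hnorm i).ge (hnorm j).ge (hdist i j hij)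
  have hVd : Disjoint V (⋃ i, diskCap (f i)) := by
    rw [Set.disjoint_left]
    intro p hp hp'
    obtain ⟨i, hi⟩ := Set.mem_iUnion.1 hp'
    have h1 := hp (f i) ⟨M i, N i, by simp [hf]⟩
    have h2 := hi.2
    rw [dist_zero_right] at h1
    linarith
  have hsub : V ∪ (⋃ i, diskCap (f i)) ⊆ Metric.closedBall (0 : Plane) hexRadius :=
    Set.union_subset (h.voronoiCell_subset 0)
      (Set.iUnion_subset fun i => diskCap_subset_closedBall _)
  have hball : volume (Metric.closedBall (0 : Plane) hexRadius) ≠ ∞ :=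
    (isCompact_closedBall _ _).measure_ne_top
  have h1 := measureReal_mono hsub hball
  have hu : volume.real (⋃ i, diskCap (f i)) = 6 * volume.real (diskCap !₂[2, 0]) := by
    rw [measureReal_iUnion_fintype hdisj (fun i => measurableSet_diskCap _)
      (fun i => volume_diskCap_ne_top _)]
    have : ∀ i, volume.real (diskCap (f i)) = volume.real (diskCap !₂[2, 0]) := fun i => by
      rw [measureReal_def, measureReal_def, volume_diskCap_congr (w := !₂[2, 0])]
      rw [hnorm, norm_planeVec_zero (by norm_num)]
    simp [this]
  rw [measureReal_union hVd (MeasurableSet.iUnion fun i => measurableSet_diskCap _)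
    (measure_ne_top_of_subset (Set.subset_union_left.trans hsub) hball)
    (measure_ne_top_of_subset (Set.subset_union_right.trans hsub) hball), hu, measureReal_def,
    h.volume_voronoiCell (self_mem 0 a b), ENNReal.toReal_ofReal (by positivity)] at h1
  exact h1

end IsHexPair

theorem isHexPair_standard : IsHexPair !₂[2, 0] !₂[1, Real.sqrt 3] where
  norm_left := norm_planeVec_zero (by norm_num)
  norm_right := by
    rw [← sq_eq_sq₀ (norm_nonneg _) (by norm_num), norm_planeVec, Real.sq_sqrt (by norm_num)]
    norm_num
  inner_eq := by simp [PiLp.inner_apply, Fin.sum_univ_two]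

/-! ### Rotation by 60 degrees -/

theorem exp_sixty_sq : Complex.exp ((Real.pi / 3 : ℝ) * Complex.I) ^ 2 =
    Complex.exp ((Real.pi / 3 : ℝ) * Complex.I) - 1 := by
  have h3 : Real.sqrt 3 ^ 2 = 3 := Real.sq_sqrt (by norm_num)
  apply Complex.ext
  · rw [sq, Complex.mul_re, Complex.sub_re, Complex.exp_ofReal_mul_I_re,
      Complex.exp_ofReal_mul_I_im, Real.cos_pi_div_three, Real.sin_pi_div_three, Complex.one_re]
    linear_combination -h3 / 4
  · rw [sq, Complex.mul_im, Complex.sub_im, Complex.exp_ofReal_mul_I_re,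
      Complex.exp_ofReal_mul_I_im, Real.cos_pi_div_three, Real.sin_pi_div_three, Complex.one_im]
    ring

/-- A primitive sixth root of unity satisfies ω² = ω - 1. Hence a vector and its rotation by 60°
generate a lattice that is closed under the rotation. -/
theorem rotateSixty_rotateSixty (v : Plane) : rotateSixty (rotateSixty v) = rotateSixty v - v := by
  apply planeToComplex.injective
  simp only [rotateSixty, map_sub, LinearIsometryEquiv.apply_symm_apply]
  rw [← mul_assoc, ← sq, exp_sixty_sq]
  ring

theorem rotateSixty_neg (v : Plane) : rotateSixty (-v) = -rotateSixty v := by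
  simp [rotateSixty]

theorem norm_rotateSixty (v : Plane) : ‖rotateSixty v‖ = ‖v‖ := by
  rw [rotateSixty, LinearIsometryEquiv.norm_map, norm_mul, Complex.norm_exp_ofReal_mul_I, one_mul,
    LinearIsometryEquiv.norm_map]

theorem inner_rotateSixty (v : Plane) : inner ℝ v (rotateSixty v) = ‖v‖ ^ 2 / 2 := by
  have h := norm_sub_sq_real (rotateSixty v) v
  rw [← rotateSixty_rotateSixty, norm_rotateSixty, norm_rotateSixty, real_inner_comm] at h
  linarith

theorem isHexPair_rotateSixty {a : Plane} (ha : ‖a‖ = 2) : IsHexPair a (rotateSixty a) where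
  norm_left := ha
  norm_right := by rw [norm_rotateSixty, ha]
  inner_eq := by rw [inner_rotateSixty, ha]; norm_num

/-! ### Minimal cell area and the case of equality -/

namespace IsCirclePacking

variable {X : Set Plane}

/-- A point q of the disk outside the cell is closer to some neighbour v than to 0. Then ‖v‖ < 2‖q‖
≤ 2 * `hexRadius`, so finitely many caps cover everything outside the cell. Overlaps of caps only
help the inequality. -/
theorem exists_nearPacking (hX : IsCirclePacking X) {x : Plane} (hx : x ∈ X) :
    ∃ F : Finset Plane, IsNearPacking F ∧
      (∀ v, v ∈ F ↔ x + v ∈ X ∧ v ≠ 0 ∧ ‖v‖ < 2 * hexRadius) ∧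
      volume.real (Metric.closedBall (0 : Plane) hexRadius) ≤
        volume.real (voronoiCell X x ∩ Metric.closedBall x hexRadius) +
          ∑ v ∈ F, volume.real (diskCap v) := by
  have hfin : {v | x + v ∈ X ∧ v ≠ 0 ∧ ‖v‖ < 2 * hexRadius}.Finite := by
    refine ((hX.finite_inter_closedBall x (2 * hexRadius)).image (fun y => y - x)).subset ?_
    rintro v ⟨hv, -, hv'⟩
    exact ⟨x + v, ⟨hv, by simpa using hv'.le⟩, by simp⟩
  refine ⟨hfin.toFinset, ⟨fun v hv => ?_, fun v hv => ?_, fun v hv w hw hne => ?_⟩,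
    fun v => by simp, ?_⟩
  · rw [Set.Finite.mem_toFinset] at hv
    have := hX _ hv.1 x hx (by simpa using hv.2.1)
    simpa using this
  · rw [Set.Finite.mem_toFinset] at hv
    exact hv.2.2
  · rw [Set.Finite.mem_toFinset] at hv hw
    have := hX _ hv.1 _ hw.1 (by simpa using hne)
    simpa using this
  · set W := (fun q => x + q) ⁻¹' (voronoiCell X x ∩ Metric.closedBall x hexRadius) with hW
    have hWv : volume W = volume (voronoiCell X x ∩ Metric.closedBall x hexRadius) :=
      measure_preimage_add _ _ _
    have hVt : volume (voronoiCell X x ∩ Metric.closedBall x hexRadius) ≠ ∞ :=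
      measure_ne_top_of_subset Set.inter_subset_right (isCompact_closedBall _ _).measure_ne_top
    have hsub : Metric.closedBall (0 : Plane) hexRadius ⊆
        W ∪ ⋃ v ∈ hfin.toFinset, diskCap v := by
      intro q hq
      rw [mem_closedBall_zero_iff] at hq
      by_cases hqW : x + q ∈ voronoiCell X x
      · exact Or.inl ⟨hqW, by simpa using hq⟩
      · right
        simp only [voronoiCell, Set.mem_ofPred_eq] at hqW
        push Not at hqW
        obtain ⟨y, hy, hlt⟩ := hqW
        have hd : dist q (y - x) < ‖q‖ := by
          rw [dist_self_add_left, ← add_sub_cancel x y, dist_add_left] at hlt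
          simpa using hlt
        rw [Set.mem_iUnion₂]
        refine ⟨y - x, ?_, hq, hd⟩
        rw [Set.Finite.mem_toFinset]
        refine ⟨by simpa using hy, ?_, ?_⟩
        · intro h0
          rw [h0, dist_zero_right] at hd
          exact lt_irrefl _ hd
        · have := dist_triangle (0 : Plane) q (y - x)
          rw [dist_zero_left, dist_zero_left] at this
          linarith
    have hUt : volume (⋃ v ∈ hfin.toFinset, diskCap v) ≠ ∞ :=
      measure_ne_top_of_subset (Set.iUnion₂_subset fun v _ => diskCap_subset_closedBall v)
        (isCompact_closedBall _ _).measure_ne_top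
    calc volume.real (Metric.closedBall (0 : Plane) hexRadius)
        ≤ volume.real (W ∪ ⋃ v ∈ hfin.toFinset, diskCap v) :=
          measureReal_mono hsub (measure_union_ne_top (hWv ▸ hVt) hUt)
      _ ≤ volume.real W + volume.real (⋃ v ∈ hfin.toFinset, diskCap v) :=
          measureReal_union_le _ _
      _ ≤ _ := by
          rw [measureReal_def volume W, hWv, ← measureReal_def]
          gcongr
          exact measureReal_biUnion_finset_le _ _

/-- The bound for the truncated cell is what the counting of centers in large disks needs, since a
whole cell may be unbounded. -/
theorem two_sqrt_three_le (hX : IsCirclePacking X) {x : Plane} (hx : x ∈ X) :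
    ENNReal.ofReal (2 * Real.sqrt 3) ≤
      volume (voronoiCell X x ∩ Metric.closedBall x hexRadius) := by
  obtain ⟨F, hF, -, hle⟩ := hX.exists_nearPacking hx
  refine ENNReal.ofReal_le_of_le_toReal ?_
  rw [← measureReal_def]
  linarith [hF.sum_volume_diskCap_le.1, isHexPair_standard.volume_diskCap_le]

/-- A cell of minimal area makes the cap estimate an equality, so the near neighbours form a regular
hexagon. -/
theorem exists_hexagon (hX : IsCirclePacking X) {x : Plane} (hx : x ∈ X)
    (h : volume (voronoiCell X x) ≤ ENNReal.ofReal (2 * Real.sqrt 3)) :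
    (∃ v, ‖v‖ = 2 ∧ x + v ∈ X) ∧ ∀ v, ‖v‖ = 2 → x + v ∈ X → x + rotateSixty v ∈ X := by
  obtain ⟨F, hF, hmem, hle⟩ := hX.exists_nearPacking hx
  have h1 : volume.real (voronoiCell X x ∩ Metric.closedBall x hexRadius) ≤ 2 * Real.sqrt 3 :=
    ENNReal.toReal_le_of_le_ofReal (by positivity)
      ((measure_mono Set.inter_subset_left).trans h)
  obtain ⟨hc, h2⟩ := hF.sum_volume_diskCap_le.2
    (by linarith [isHexPair_standard.volume_diskCap_le])
  constructor
  · obtain ⟨v, hv⟩ := Finset.card_pos.1 (show 0 < F.card by omega)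
    exact ⟨v, h2 v hv, ((hmem v).1 hv).1⟩
  · intro v hv hxv
    have hvF : v ∈ F := (hmem v).2 ⟨hxv, by rw [← norm_pos_iff, hv]; norm_num, by
      nlinarith [hexRadius_sq, hexRadius_pos]⟩
    exact ((hmem _).1 (hF.rotateSixty_mem hc h2 hvF)).1

theorem isHexagonalLatticePacking (hX : IsCirclePacking X) (hne : X.Nonempty)
    (h : ∀ x ∈ X, volume (voronoiCell X x) ≤ ENNReal.ofReal (2 * Real.sqrt 3)) :
    IsHexagonalLatticePacking X := by
  obtain ⟨c, hc⟩ := hne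
  obtain ⟨a, ha, hca⟩ := (hX.exists_hexagon hc (h c hc)).1
  have rot : ∀ x ∈ X, ∀ v, ‖v‖ = 2 → x + v ∈ X → x + rotateSixty v ∈ X := fun x hx =>
    (hX.exists_hexagon hx (h x hx)).2
  -- Two rotations about x give 120° and three give 180°, so each neighbour at distance 2 has its
  -- opposite in `X`.
  have rot₂ : ∀ x ∈ X, ∀ v, ‖v‖ = 2 → x + v ∈ X → x + (rotateSixty v - v) ∈ X := by
    intro x hx v hv hxv
    rw [← rotateSixty_rotateSixty]
    exact rot x hx _ (by rw [norm_rotateSixty, hv]) (rot x hx v hv hxv)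
  have rot₃ : ∀ x ∈ X, ∀ v, ‖v‖ = 2 → x + v ∈ X → x - v ∈ X := by
    intro x hx v hv hxv
    have h1 := rot₂ x hx _ (by rw [norm_rotateSixty, hv]) (rot x hx v hv hxv)
    rw [rotateSixty_rotateSixty] at h1
    convert h1 using 1
    module
  set b := rotateSixty a with hb
  have hbn : ‖b‖ = 2 := by rw [hb, norm_rotateSixty, ha]
  have hpair : IsHexPair a b := isHexPair_rotateSixty ha
  -- Carrying the neighbour in direction a along with x keeps the orientation of the hexagon fixed,
  -- so all hexagons belong to the same lattice.
  let P : Plane → Prop := fun x => x ∈ X ∧ x + a ∈ X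
  have add_a : ∀ x, P x → P (x + a) := fun x hx => by
    refine ⟨hx.2, ?_⟩
    have := rot₃ (x + a) hx.2 (-a) (by rw [norm_neg, ha]) (by simpa using hx.1)
    simpa using this
  have sub_a : ∀ x, P x → P (x - a) := fun x hx =>
    ⟨rot₃ x hx.1 a ha hx.2, by simpa using hx.1⟩
  have add_b : ∀ x, P x → P (x + b) := fun x hx => by
    have h1 : x + b ∈ X := rot x hx.1 a ha hx.2
    refine ⟨h1, ?_⟩
    have h2 := rot₂ (x + b) h1 (-b) (by rw [norm_neg, hbn]) (by simpa using hx.1)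
    rw [rotateSixty_neg, hb, rotateSixty_rotateSixty] at h2
    convert h2 using 1
    module
  have sub_b : ∀ x, P x → P (x - b) := fun x hx => by
    have h1 : x - b ∈ X := rot₃ x hx.1 b hbn (rot x hx.1 a ha hx.2)
    refine ⟨h1, ?_⟩
    have h2 := rot₂ (x - b) h1 b hbn (by simpa using hx.1)
    rw [hb, rotateSixty_rotateSixty, ← hb] at h2
    have h3 := rot₃ (x - b) h1 (-a) (by rw [norm_neg, ha]) (by convert h2 using 1; module)
    simpa using h3
  have hm : ∀ m : ℤ, P (c + (m : ℝ) • a) := by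
    intro m
    induction m using Int.induction_on with
    | zero => exact ⟨by simpa using hc, by simpa using hca⟩
    | succ i ih =>
      have := add_a _ ih
      push_cast at this ⊢
      rwa [add_smul, one_smul, ← add_assoc]
    | pred i ih =>
      have := sub_a _ ih
      push_cast at this ⊢
      rwa [sub_smul, one_smul, ← add_sub_assoc]
  have hmn : ∀ m n : ℤ, P (c + (m : ℝ) • a + (n : ℝ) • b) := by
    intro m n
    induction n using Int.induction_on with
    | zero => simpa using hm m
    | succ i ih =>
      have := add_b _ ih
      push_cast at this ⊢
      rwa [add_smul, one_smul, ← add_assoc]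
    | pred i ih =>
      have := sub_b _ ih
      push_cast at this ⊢
      rwa [sub_smul, one_smul, ← add_sub_assoc]
  have hsub : latticeTranslate c a b ⊆ X := by
    rintro _ ⟨m, n, rfl⟩
    exact (hmn m n).1
  refine ⟨c, a, b, ha, hbn, hpair.inner_eq, Set.Subset.antisymm (fun p hp => ?_) hsub⟩
  -- The covering radius of the lattice is less than 2, so no further center fits.
  obtain ⟨x, hx, hd⟩ := hpair.exists_dist_le c p
  by_contra hpn
  have hpx : p ≠ x := by
    rintro rfl
    exact hpn hx
  linarith [hX p hp x (hsub hx) hpx, hexRadius_lt_two]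

end IsCirclePacking

/-! ### Cell densities and asymptotic densities -/

theorem volume_closedBall_plane (x : Plane) {R : ℝ} (hR : 0 ≤ R) :
    volume (Metric.closedBall x R) = ENNReal.ofReal (Real.pi * R ^ 2) := by
  rw [EuclideanSpace.volume_closedBall_fin_two, ← ENNReal.ofReal_pow hR,
    ← ENNReal.ofReal_mul (by positivity), mul_comm]

theorem cellDensity_eq (X : Set Plane) (x : Plane) :
    cellDensity X x = ENNReal.ofReal Real.pi / volume (voronoiCell X x) := by
  rw [cellDensity, volume_closedBall_plane _ zero_le_one, one_pow, mul_one]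

theorem ofReal_hexDensity : ENNReal.ofReal (Real.pi / (2 * Real.sqrt 3)) =
    ENNReal.ofReal Real.pi / ENNReal.ofReal (2 * Real.sqrt 3) :=
  ENNReal.ofReal_div_of_pos (by positivity)

theorem IsHexPair.cellDensity_eq {a b c x : Plane} (h : IsHexPair a b)
    (hx : x ∈ latticeTranslate c a b) : cellDensity (latticeTranslate c a b) x =
      ENNReal.ofReal (Real.pi / (2 * Real.sqrt 3)) := by
  rw [_root_.cellDensity_eq, h.volume_voronoiCell hx, ofReal_hexDensity]

/-- The empty packing satisfies `HasMaximalDensity` vacuously; saturation excludes it. -/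
theorem IsSaturatedPacking.nonempty {X : Set Plane} (hX : IsSaturatedPacking X) : X.Nonempty := by
  by_contra h
  rw [Set.not_nonempty_iff_eq_empty] at h
  refine hX.2 {0} (fun x hx y hy hne => absurd (hx.trans hy.symm) hne) ?_
  rw [h]
  exact Set.empty_ssubset_singleton

theorem tendsto_ofReal_hexDensity_mul (s : ℝ) :
    Tendsto (fun R : ℝ => ENNReal.ofReal (Real.pi / (2 * Real.sqrt 3) * (1 + s / R) ^ 2)) atTop
      (𝓝 (ENNReal.ofReal (Real.pi / (2 * Real.sqrt 3)))) := by
  refine ENNReal.tendsto_ofReal ?_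
  have h : Tendsto (fun R : ℝ => 1 + s / R) atTop (𝓝 (1 + 0)) :=
    (tendsto_const_nhds.div_atTop tendsto_id).const_add 1
  simpa using (h.pow 2).const_mul (Real.pi / (2 * Real.sqrt 3))

namespace IsCirclePacking

variable {X : Set Plane}

theorem cellDensity_le (hX : IsCirclePacking X) {x : Plane} (hx : x ∈ X) :
    cellDensity X x ≤ ENNReal.ofReal (Real.pi / (2 * Real.sqrt 3)) := by
  rw [cellDensity_eq, ofReal_hexDensity]
  exact ENNReal.div_le_div_left
    ((hX.two_sqrt_three_le hx).trans (measure_mono Set.inter_subset_left)) _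

/-- The truncated cells of the centers in the disk of radius R are almost disjoint and stay in the
disk of radius R + 2, because `hexRadius` is less than 2. -/
theorem card_mul_le (hX : IsCirclePacking X) {R : ℝ} (hR : 0 ≤ R) :
    ((hX.finite_inter_closedBall 0 R).toFinset.card : ℝ) * (2 * Real.sqrt 3) ≤
      Real.pi * (R + 2) ^ 2 := by
  set S := (hX.finite_inter_closedBall 0 R).toFinset with hS
  have hmem : ∀ x ∈ S, x ∈ X ∧ ‖x‖ ≤ R := fun x hx => by
    rw [hS, Set.Finite.mem_toFinset] at hx
    exact ⟨hx.1, by simpa using hx.2⟩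
  have h1 : volume (⋃ x ∈ S, voronoiCell X x ∩ Metric.closedBall x hexRadius) ≤
      ENNReal.ofReal (Real.pi * (R + 2) ^ 2) := by
    rw [← volume_closedBall_plane 0 (by linarith)]
    refine measure_mono (Set.iUnion₂_subset fun x hx p hp => ?_)
    have h2 := (hmem x hx).2
    have h3 := hp.2
    rw [Metric.mem_closedBall] at h3 ⊢
    have h4 := dist_triangle p x 0
    rw [dist_zero_right x] at h4
    linarith [hexRadius_lt_two]
  rw [measure_biUnion_finset₀] at h1
  · have h2 : S.card • ENNReal.ofReal (2 * Real.sqrt 3) ≤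
        ∑ x ∈ S, volume (voronoiCell X x ∩ Metric.closedBall x hexRadius) :=
      Finset.card_nsmul_le_sum _ _ _ fun x hx => hX.two_sqrt_three_le (hmem x hx).1
    have h3 := h2.trans h1
    rw [← ENNReal.ofReal_nsmul, ENNReal.ofReal_le_ofReal_iff (by positivity), nsmul_eq_mul] at h3
    exact h3
  · intro x hx y hy hne
    exact (aedisjoint_voronoiCell (hmem x hx).1 (hmem y hy).1 hne).mono Set.inter_subset_left
      Set.inter_subset_left
  · exact fun x _ => ((isClosed_voronoiCell X x).inter
      Metric.isClosed_closedBall).measurableSet.nullMeasurableSet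

/-- The 3 is 1 for the unit disks that reach across the boundary plus 2 for the cells of their
centers. -/
theorem coveredFraction_le (hX : IsCirclePacking X) {R : ℝ} (hR : 0 < R) :
    coveredFraction X R ≤ ENNReal.ofReal (Real.pi / (2 * Real.sqrt 3) * (1 + 3 / R) ^ 2) := by
  set S := (hX.finite_inter_closedBall 0 (R + 1)).toFinset with hS
  have h1 : volume ((⋃ x ∈ X, Metric.closedBall x 1) ∩ Metric.closedBall 0 R) ≤
      ENNReal.ofReal (S.card * Real.pi) := by
    have hsub : (⋃ x ∈ X, Metric.closedBall x 1) ∩ Metric.closedBall 0 R ⊆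
        ⋃ x ∈ S, Metric.closedBall x 1 := by
      rintro p ⟨hp, hpR⟩
      obtain ⟨x, hx, hpx⟩ := Set.mem_iUnion₂.1 hp
      refine Set.mem_iUnion₂.2 ⟨x, ?_, hpx⟩
      rw [hS, Set.Finite.mem_toFinset]
      refine ⟨hx, ?_⟩
      rw [Metric.mem_closedBall] at hpx hpR ⊢
      linarith [dist_triangle_left x 0 p]
    refine (measure_mono hsub).trans ((measure_biUnion_finset_le _ _).trans ?_)
    simp only [volume_closedBall_plane _ zero_le_one, one_pow, mul_one, Finset.sum_const]
    rw [← ENNReal.ofReal_nsmul, nsmul_eq_mul]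
  have h2 := hX.card_mul_le (show 0 ≤ R + 1 by linarith)
  rw [coveredFraction, volume_closedBall_plane 0 hR.le]
  refine (ENNReal.div_le_div_right h1 _).trans ?_
  rw [← ENNReal.ofReal_div_of_pos (by positivity)]
  refine ENNReal.ofReal_le_ofReal ?_
  rw [show 1 + 3 / R = (R + 1 + 2) / R by field_simp; ring, div_pow, div_mul_div_comm,
    div_le_div_iff₀ (by positivity) (by positivity)]
  have h3 := mul_le_mul_of_nonneg_right h2 (show 0 ≤ Real.pi * R ^ 2 by positivity)
  linarith

theorem upperDensity_le (hX : IsCirclePacking X) :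
    upperDensity X ≤ ENNReal.ofReal (Real.pi / (2 * Real.sqrt 3)) := by
  rw [← (tendsto_ofReal_hexDensity_mul 3).limsup_eq]
  refine limsup_le_limsup ?_
  filter_upwards [eventually_gt_atTop 0] with R hR
  exact hX.coveredFraction_le hR

end IsCirclePacking

namespace IsHexPair

variable {a b : Plane}

/-- Lattice cells have radius below 2, so those with centers in the disk of radius R + 2 already
cover the disk of radius R. -/
theorem le_card_mul (h : IsHexPair a b) (c : Plane) {R : ℝ} (hR : 0 ≤ R) :
    Real.pi * R ^ 2 ≤ (((h.isCirclePacking c).finite_inter_closedBall 0 (R + 2)).toFinset.card : ℝ)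
      * (2 * Real.sqrt 3) := by
  set S := ((h.isCirclePacking c).finite_inter_closedBall 0 (R + 2)).toFinset with hS
  have hsub : Metric.closedBall (0 : Plane) R ⊆
      ⋃ x ∈ S, voronoiCell (latticeTranslate c a b) x := by
    intro p hp
    obtain ⟨x, hx, hpx⟩ := (h.isCirclePacking c).exists_mem_voronoiCell ⟨c, self_mem c a b⟩ p
    refine Set.mem_iUnion₂.2 ⟨x, ?_, hpx⟩
    rw [hS, Set.Finite.mem_toFinset]
    refine ⟨hx, ?_⟩
    have h1 := h.voronoiCell_subset_of_mem hx hpx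
    rw [Metric.mem_closedBall] at hp h1 ⊢
    linarith [dist_triangle_left x 0 p, hexRadius_lt_two]
  have h2 : volume (Metric.closedBall (0 : Plane) R) ≤
      ∑ x ∈ S, volume (voronoiCell (latticeTranslate c a b) x) :=
    (measure_mono hsub).trans (measure_biUnion_finset_le _ _)
  have h3 : ∀ x ∈ S, volume (voronoiCell (latticeTranslate c a b) x) =
      ENNReal.ofReal (2 * Real.sqrt 3) := fun x hx => by
    rw [hS, Set.Finite.mem_toFinset] at hx
    exact h.volume_voronoiCell hx.1
  rw [Finset.sum_congr rfl h3, Finset.sum_const, ← ENNReal.ofReal_nsmul,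
    volume_closedBall_plane 0 hR, ENNReal.ofReal_le_ofReal_iff (by positivity), nsmul_eq_mul] at h2
  exact h2

theorem le_coveredFraction (h : IsHexPair a b) (c : Plane) {R : ℝ} (hR : 3 ≤ R) :
    ENNReal.ofReal (Real.pi / (2 * Real.sqrt 3) * (1 + -3 / R) ^ 2) ≤
      coveredFraction (latticeTranslate c a b) R := by
  have hX := h.isCirclePacking c
  -- Unit disks with centers in the disk of radius R - 1 lie inside radius R, and the cells of these
  -- centers cover radius R - 3.
  have h2 := h.le_card_mul c (show 0 ≤ R - 3 by linarith)
  rw [show R - 3 + 2 = R - 1 by ring] at h2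
  set S := (hX.finite_inter_closedBall 0 (R - 1)).toFinset with hS
  have hmem : ∀ x ∈ S, x ∈ latticeTranslate c a b ∧ ‖x‖ ≤ R - 1 := fun x hx => by
    rw [hS, Set.Finite.mem_toFinset] at hx
    exact ⟨hx.1, by simpa using hx.2⟩
  have h1 : ENNReal.ofReal (S.card * Real.pi) ≤
      volume ((⋃ x ∈ latticeTranslate c a b, Metric.closedBall x 1) ∩ Metric.closedBall 0 R) := by
    have hsub : (⋃ x ∈ S, Metric.ball x 1) ⊆
        (⋃ x ∈ latticeTranslate c a b, Metric.closedBall x 1) ∩ Metric.closedBall 0 R := by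
      refine Set.iUnion₂_subset fun x hx p hp => ⟨Set.mem_iUnion₂.2
        ⟨x, (hmem x hx).1, Metric.ball_subset_closedBall hp⟩, ?_⟩
      have h3 := (hmem x hx).2
      have h4 := dist_triangle p x 0
      rw [dist_zero_right x] at h4
      rw [Metric.mem_ball] at hp
      rw [Metric.mem_closedBall]
      linarith
    refine le_trans ?_ (measure_mono hsub)
    rw [measure_biUnion_finset]
    · simp only [← Measure.addHaar_closedBall_eq_addHaar_ball,
        volume_closedBall_plane _ zero_le_one, one_pow, mul_one, Finset.sum_const]
      rw [← ENNReal.ofReal_nsmul, nsmul_eq_mul]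
    · intro x hx y hy hne
      refine Metric.ball_disjoint_ball ?_
      linarith [hX x (hmem x hx).1 y (hmem y hy).1 hne]
    · exact fun x _ => Metric.isOpen_ball.measurableSet
  have hR0 : 0 < R := by linarith
  rw [coveredFraction, volume_closedBall_plane 0 hR0.le]
  refine le_trans ?_ (ENNReal.div_le_div_right h1 _)
  rw [← ENNReal.ofReal_div_of_pos (by positivity)]
  refine ENNReal.ofReal_le_ofReal ?_
  rw [show 1 + -3 / R = (R - 3) / R by field_simp; ring, div_pow, div_mul_div_comm,
    div_le_div_iff₀ (by positivity) (by positivity)]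
  have h3 := mul_le_mul_of_nonneg_right h2 (show 0 ≤ Real.pi * R ^ 2 by positivity)
  linarith

theorem tendsto_coveredFraction (h : IsHexPair a b) (c : Plane) :
    Tendsto (coveredFraction (latticeTranslate c a b)) atTop
      (𝓝 (ENNReal.ofReal (Real.pi / (2 * Real.sqrt 3)))) := by
  refine tendsto_of_tendsto_of_tendsto_of_le_of_le' (tendsto_ofReal_hexDensity_mul (-3))
    (tendsto_ofReal_hexDensity_mul 3) ?_ ?_
  · filter_upwards [eventually_ge_atTop 3] with R hR
    exact h.le_coveredFraction c hR
  · filter_upwards [eventually_gt_atTop 0] with R hR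
    exact (h.isCirclePacking c).coveredFraction_le hR

end IsHexPair

theorem IsHexagonalLatticePacking.exists_isHexPair {X : Set Plane}
    (h : IsHexagonalLatticePacking X) :
    ∃ c a b, IsHexPair a b ∧ X = latticeTranslate c a b := by
  obtain ⟨c, a, b, ha, hb, hab, rfl⟩ := h
  exact ⟨c, a, b, ⟨ha, hb, hab⟩, rfl⟩

/-- Maximality is tested against a hexagonal lattice packing, which exhibits the optimal density. -/
theorem HasMaximalDensity.volume_voronoiCell_le {X : Set Plane} (h : HasMaximalDensity X)
    {x : Plane} (hx : x ∈ X) :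
    volume (voronoiCell X x) ≤ ENNReal.ofReal (2 * Real.sqrt 3) := by
  have h1 := h x hx _ (isHexPair_standard.isCirclePacking 0) 0 (IsHexPair.self_mem _ _ _)
  rw [isHexPair_standard.cellDensity_eq (IsHexPair.self_mem _ _ _), cellDensity_eq,
    ofReal_hexDensity, div_eq_mul_inv, div_eq_mul_inv,
    ENNReal.mul_le_mul_iff_right (by simp [Real.pi_pos]) ENNReal.ofReal_ne_top,
    ENNReal.inv_le_inv] at h1
  exact h1

theorem theorem9p1 (X : Set Plane) (hX : IsSaturatedPacking X) :
    (HasMaximalDensity X ↔ IsHexagonalLatticePacking X) ∧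
    (∀ x ∈ X, cellDensity X x ≤ ENNReal.ofReal (Real.pi / (2 * Real.sqrt 3))) ∧
    (IsHexagonalLatticePacking X →
      (∀ x ∈ X, cellDensity X x = ENNReal.ofReal (Real.pi / (2 * Real.sqrt 3))) ∧
      Tendsto (coveredFraction X) atTop (𝓝 (ENNReal.ofReal (Real.pi / (2 * Real.sqrt 3))))) ∧
    (∀ Y : Set Plane, IsCirclePacking Y →
      upperDensity Y ≤ ENNReal.ofReal (Real.pi / (2 * Real.sqrt 3))) := by
  refine ⟨⟨fun h => ?_, fun h x hx Y hY y hy => ?_⟩, fun x hx => hX.1.cellDensity_le hx,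
    fun h => ?_, fun Y hY => hY.upperDensity_le⟩
  · exact hX.1.isHexagonalLatticePacking hX.nonempty fun x hx => h.volume_voronoiCell_le hx
  · obtain ⟨c, a, b, hab, rfl⟩ := h.exists_isHexPair
    rw [hab.cellDensity_eq hx]
    exact hY.cellDensity_le hy
  · obtain ⟨c, a, b, hab, rfl⟩ := h.exists_isHexPair
    exact ⟨fun x hx => hab.cellDensity_eq hx, hab.tendsto_coveredFraction c⟩
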